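/- **Setting.** For $c\in\mathbb R$, $n\in\mathbb N$ write $[c,c+n]_{\mathbb N_c}=\{c,c+1,\dots,c+n\}$. Let $1<\upsilon<2$, $0<\mu<1$, $b\in\mathbb N$, $\alpha\in\mathbb R$ with $|\alpha|<1$, and $I=\{0,1,\dots,b+1\}$. Let $t^{(\nu)}=\Gamma(t+1)/\Gamma(t+1-\nu)$ (equal to $0$ when $t+1-\nu$ is a pole of $\Gamma$ and $t+1$ is not). For $\nu>0$ and a function $u$ on $\mathbb N_a=\{a,a+1,\dots\}$, the fractional sum is $\Delta^{-\nu}u(t)=\frac1{\Gamma(\nu)}\sum_{s=a}^{t-\nu}(t-s-1)^{(\nu-1)}u(s)$, and for non-integer $\nu$ with $N-1<\nu<N$, $N\in\mathbb N$, the Riemann–Liouville fractional difference is $\Delta^{\nu}u=\Delta^{N}\Delta^{-(N-\nu)}u$, where $\Delta u(t)=u(t+1)-u(t)$. Let $$e_{p,q}(\lambda,x)=\sum_{k=0}^\infty \lambda^k\frac{(x+kp+q-1)^{(kp+q-1)}}{\Gamma(kp+q)},$$ assume $e_{\upsilon-\mu,\upsilon}(\alpha,b+2)\neq0$, and let $G$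 be the Green's function $$G(t,s)=\frac{e_{\upsilon-\mu,\upsilon}(\alpha,t-\upsilon+1)}{e_{\upsilon-\mu,\upsilon}(\alpha,b+2)}\,e_{\upsilon-\mu,\upsilon}(\alpha,\upsilon+b-s)-\begin{cases}e_{\upsilon-\mu,\upsilon}(\alpha,t-s-1),& s\le t,\\ 0,& s>t,\end{cases}$$ for $t\in[\upsilon-2,\upsilon+b+1]_{\mathbb N_{\upsilon-2}}$ and $s\in[\upsilon-1,\upsilon+b]_{\mathbb N_{\upsilon-1}}$. Let $f:[\upsilon-1,\upsilon+b]_{\mathbb N_{\upsilon-1}}\times\mathbb R\to\mathbb R$ be continuous, and consider, for $y:[\upsilon-2,\upsilon+b+1]_{\mathbb N_{\upsilon-2}}\to\mathbb R$ (fractional differences taken with $a=\upsilon-2$), the problem $$-\Delta^{\upsilon}y(t)+\alpha\,(\Delta^{\mu}y)(t+\upsilon-\mu)=f(t+\upsilon-1,y(t+\upsilon-1)),\quad t\in I,\qquad y(\upsilon-2)=y(\upsilon+b+1)=0.\tag{P}$$ **Theorem.** Assume: (A1) there are a nondecreasing $\psi:[0,\infty)\to[0,\infty)$ and $g:[\upsilon-2,\upsilon+b+1]_{\mathbb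 N_{\upsilon-2}}\to[0,\infty)$ with $|f(t+\upsilon-1,r)|\le g(t+\upsilon-1)\,\psi(|r|)$ for all $t\in I$, $r\in\mathbb R$; (A2) there is $L>0$ with $$\frac{L}{\psi(L)\,\displaystyle\max_{t\in[\upsilon-2,\upsilon+b+1]_{\mathbb N_{\upsilon-2}}}\sum_{s=\upsilon-1}^{\upsilon+b}g(s)\,|G(t,s)|}>1,$$ where the quotient is read as $+\infty$ if its denominator is $0$ (that is, the denominator is smaller than $L$). Then (P) has a solution $y$ on $[\upsilon-2,\upsilon+b+1]_{\mathbb N_{\upsilon-2}}$. Moreover, if $f(t+\upsilon-1,0)\ne0$ for at least one $t\in I$, then every solution $y$ of (P) satisfies $y\not\equiv0$ on $[\upsilon-2,\upsilon+b+1]_{\mathbb N_{\upsilon-2}}$. -/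

import Mathlib

noncomputable section

namespace FracDirichlet

/-- The discrete interval `[c, c + n]_{ℕ_c} = {c, c + 1, …, c + n}` of real numbers. -/
def grid (c : ℝ) (n : ℕ) : Finset ℝ :=
  (Finset.range (n + 1)).map ⟨fun k : ℕ => c + (k : ℝ), fun i j h => by simpa using h⟩

theorem mem_grid {c x : ℝ} {n : ℕ} : x ∈ grid c n ↔ ∃ k : ℕ, k ≤ n ∧ c + (k : ℝ) = x := by
  simp only [grid, Finset.mem_map, Finset.mem_range, Nat.lt_succ_iff]
  exact Iff.rfl

theorem grid_nonempty (c : ℝ) (n : ℕ) : (grid c n).Nonempty :=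
  ⟨c, mem_grid.2 ⟨0, Nat.zero_le n, by simp⟩⟩

/-- The falling factorial power `t^{(ν)} = Γ(t + 1) / Γ(t + 1 - ν)`.  Since Mathlib puts `Γ = 0` at
the poles and `x / 0 = 0`, it is `0` when `t + 1 - ν` is a pole, which is the usual convention. -/
def fallingPow (t ν : ℝ) : ℝ :=
  Real.Gamma (t + 1) / Real.Gamma (t + 1 - ν)

/-- The `ν`-th fractional sum (`ν > 0`) with base point `a`,
`Δ^{-ν} f(t) = (1 / Γ(ν)) ∑_{s = a}^{t - ν} (t - s - 1)^{(ν - 1)} f(s)` for `t ∈ ℕ_{a + ν}`.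
The summation variable is `s = a + k`; for `t = a + ν + n` the range of `k` is `0, …, n`. -/
def fracSum (ν a : ℝ) (f : ℝ → ℝ) (t : ℝ) : ℝ :=
  1 / Real.Gamma ν *
    ∑ k ∈ Finset.range ⌊t - ν - a + 1⌋₊, fallingPow (t - (a + k) - 1) (ν - 1) * f (a + k)

/-- The Riemann–Liouville fractional difference `Δ^ν f = Δ^N Δ^{-(N - ν)} f` with base point `a`,
of non-integer order `ν > 0`, where `N - 1 < ν < N` and `Δ u(t) = u(t + 1) - u(t)`. -/
def fracDiff (ν a : ℝ) (f : ℝ → ℝ) (t : ℝ) : ℝ :=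
  (fwdDiff (1 : ℝ))^[⌈ν⌉₊] (fracSum ((⌈ν⌉₊ : ℝ) - ν) a f) t

/-- The two parameter delta discrete Mittag-Leffler function `e_{p,q}(lam, x)`. -/
def mittagLeffler (p q lam x : ℝ) : ℝ :=
  ∑' k : ℕ, lam ^ k * (fallingPow (x + k * p + q - 1) (k * p + q - 1) / Real.Gamma (k * p + q))

/-- The Green's function of the linear Dirichlet problem
`-Δ^υ y(t) + α Δ^μ y(t + υ - μ) = h(t + υ - 1)`, `y(υ - 2) = y(υ + b + 1) = 0`. -/
def green (α υ μ : ℝ) (b : ℕ) (t s : ℝ) : ℝ :=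
  if s ≤ t then
    mittagLeffler (υ - μ) υ α (t - υ + 1) / mittagLeffler (υ - μ) υ α (b + 2) *
        mittagLeffler (υ - μ) υ α (υ + b - s)
      - mittagLeffler (υ - μ) υ α (t - s - 1)
  else
    mittagLeffler (υ - μ) υ α (t - υ + 1) / mittagLeffler (υ - μ) υ α (b + 2) *
        mittagLeffler (υ - μ) υ α (υ + b - s)

/-- `y` solves the nonlinear Dirichlet problem.  Only the values of `y` on
`{υ - 2, υ - 1, …, υ + b + 1}` and of `f` at first arguments in `{υ - 1, …, υ + b}` enter. -/
structure IsSolution (α υ μ : ℝ) (b : ℕ) (f : ℝ → ℝ → ℝ) (y : ℝ → ℝ) : Prop where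
  equation : ∀ t ∈ grid 0 (b + 1),
    -fracDiff υ (υ - 2) y t + α * fracDiff μ (υ - 2) y (t + υ - μ)
      = f (t + υ - 1) (y (t + υ - 1))
  left : y (υ - 2) = 0
  right : y (υ + b + 1) = 0

end FracDirichlet

end

noncomputable section

namespace FracDirichlet

open PowerSeries

/-! Encode `y` by the power series of its values from `υ - 2` on. Fractional sums and differences of
order `ν` become multiplication by `(1 - X)^(∓ν)`, so the linear operator has symbol `(1 - X)^υ - α
(1 - X)^μ`, up to sign. Expanding its inverse geometrically gives the Mittag-Leffler series
(`symbol_mul_mittagLefflerSeries`). Hence solutions vanishing on the left come from an explicit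
Volterra recursion with one free parameter `c`. Existence is by shooting rather than by a fixed
point theorem. Clamp the argument of `f` to `[-L, L]`, so that the nonlinearity is bounded; the
intermediate value theorem in `c` then meets the right boundary condition
(`exists_volterra_eq_zero`). The Green representation (`volterra_eq_sum_green`) and (A2) give `|y| ≤
L`, so the clamp is inactive. -/

/-! ### Binomial series and their coefficients. -/

/-- The power series `(1 - X) ^ (-r)`. -/
def negBinomial (r : ℝ) : PowerSeries ℝ :=
  rescale (-1 : ℝ) (binomialSeries ℝ (-r))

theorem negBinomial_add (r s : ℝ) : negBinomial (r + s) = negBinomial r * negBinomial s := by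
  rw [negBinomial, neg_add, binomialSeries_add, map_mul]; rfl

theorem negBinomial_zero : negBinomial 0 = 1 := by
  simp [negBinomial]

theorem negBinomial_neg_one : negBinomial (-1) = 1 - X := by
  have h := binomialSeries_nat (R := ℝ) (A := ℝ) 1
  rw [Nat.cast_one, pow_one] at h
  rw [negBinomial, neg_neg, h]
  simp [rescale_X, sub_eq_add_neg]

theorem coeff_negBinomial_zero (r : ℝ) : coeff 0 (negBinomial r) = 1 := by
  simp [negBinomial]

theorem coeff_negBinomial_succ (r : ℝ) (n : ℕ) :
    coeff (n + 1) (negBinomial r) = coeff n (negBinomial r) * ((r + n) / (n + 1)) := by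
  have hn : ((n : ℝ) + 1) ≠ 0 := by positivity
  have hf : (n.factorial : ℝ) ≠ 0 := by positivity
  simp only [negBinomial, coeff_rescale, binomialSeries_coeff, Ring.choose_eq_smul,
    descPochhammer_succ_right, Polynomial.smeval_mul, Polynomial.smeval_sub, Polynomial.smeval_X,
    Polynomial.smeval_natCast, smul_eq_mul, Nat.factorial_succ, Nat.cast_mul, Nat.cast_succ,
    nsmul_eq_mul, pow_succ]
  field_simp
  ring

theorem coeff_negBinomial_eq_Gamma {r : ℝ} (hr : 0 < r) (n : ℕ) :
    coeff n (negBinomial r) = Real.Gamma (n + r) / Real.Gamma (n + 1) / Real.Gamma r := by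
  have hG := (Real.Gamma_pos_of_pos hr).ne'
  induction n with
  | zero => simp [coeff_negBinomial_zero, hG, -coeff_zero_eq_constantCoeff]
  | succ n ih =>
    have h1 : Real.Gamma ((n + 1 : ℕ) + r) = (n + r) * Real.Gamma (n + r) := by
      rw [← Real.Gamma_add_one (by positivity)]; push_cast; ring_nf
    have h2 : Real.Gamma ((n + 1 : ℕ) + 1) = (n + 1) * Real.Gamma (n + 1) := by
      rw [← Real.Gamma_add_one (by positivity)]; push_cast; ring_nf
    have h3 : Real.Gamma ((n : ℝ) + 1) ≠ 0 := (Real.Gamma_pos_of_pos (by positivity)).ne'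
    rw [coeff_negBinomial_succ, ih, h1, h2]
    have : (n : ℝ) + 1 ≠ 0 := by positivity
    field_simp
    ring

/-- Passing from `n` to `n + 1` multiplies the coefficient by a factor affine in `k`; the weight `k
^ m` lets the induction absorb it. -/
theorem summable_pow_mul_coeff_negBinomial {lam : ℝ} (hlam : |lam| < 1) (p q : ℝ) (n : ℕ) :
    ∀ m : ℕ, Summable fun k : ℕ =>
      (k : ℝ) ^ m * lam ^ k * coeff n (negBinomial (k * p + q)) := by
  induction n with
  | zero =>
    intro m
    simpa only [coeff_negBinomial_zero, mul_one] using
      summable_pow_mul_geometric_of_norm_lt_one m (by simpa using hlam)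
  | succ n ih =>
    intro m
    refine (((ih (m + 1)).mul_right (p / (n + 1))).add
      ((ih m).mul_right ((q + n) / (n + 1)))).congr fun k => ?_
    rw [coeff_negBinomial_succ]
    ring

theorem summable_coeff_negBinomial {lam : ℝ} (hlam : |lam| < 1) (p q : ℝ) (n : ℕ) :
    Summable fun k : ℕ => lam ^ k * coeff n (negBinomial (k * p + q)) := by
  simpa using summable_pow_mul_coeff_negBinomial hlam p q n 0

/-! ### The Mittag-Leffler series as inverse of the symbol. -/

theorem mittagLeffler_natCast {p q : ℝ} (hp : 0 < p) (hq : 0 < q) (lam : ℝ) (n : ℕ) :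
    mittagLeffler p q lam n = ∑' k : ℕ, lam ^ k * coeff n (negBinomial (k * p + q)) := by
  refine tsum_congr fun k => ?_
  rw [coeff_negBinomial_eq_Gamma (by positivity), fallingPow]
  ring_nf

theorem mittagLeffler_neg_one (p q lam : ℝ) : mittagLeffler p q lam (-1) = 0 := by
  have (k : ℕ) : fallingPow (-1 + k * p + q - 1) (k * p + q - 1) = 0 := by
    rw [fallingPow, show (-1 + k * p + q - 1 + 1 - (k * p + q - 1) : ℝ) = 0 by ring,
      Real.Gamma_zero, div_zero]
  simp [mittagLeffler, this]

/-- The generating function of the values of the discrete Mittag-Leffler function at `0, 1, …`. -/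
def mittagLefflerSeries (p q lam : ℝ) : PowerSeries ℝ :=
  PowerSeries.mk fun n => mittagLeffler p q lam n

theorem coeff_negBinomial_mul_mittagLefflerSeries {p q lam : ℝ} (hp : 0 < p) (hq : 0 < q)
    (hlam : |lam| < 1) (s : ℝ) (n : ℕ) :
    coeff n (negBinomial s * mittagLefflerSeries p q lam) =
      ∑' k : ℕ, lam ^ k * coeff n (negBinomial (k * p + (q + s))) := by
  have key (k : ℕ) : lam ^ k * coeff n (negBinomial (k * p + (q + s))) =
      ∑ ij ∈ Finset.HasAntidiagonal.antidiagonal n, coeff ij.1 (negBinomial s) *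
        (lam ^ k * coeff ij.2 (negBinomial (k * p + q))) := by
    rw [show (k * p + (q + s) : ℝ) = s + (k * p + q) by ring, negBinomial_add, coeff_mul,
      Finset.mul_sum]
    exact Finset.sum_congr rfl fun _ _ => by ring
  simp_rw [key]
  have hsum (ij : ℕ × ℕ) : Summable fun k : ℕ => coeff ij.1 (negBinomial s) *
      (lam ^ k * coeff ij.2 (negBinomial (k * p + q))) :=
    Summable.mul_left (coeff ij.1 (negBinomial s)) (summable_coeff_negBinomial hlam p q ij.2)
  rw [Summable.tsum_finsetSum fun ij _ => hsum ij, coeff_mul]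
  refine Finset.sum_congr rfl fun ij _ => ?_
  rw [tsum_mul_left, mittagLefflerSeries, coeff_mk, mittagLeffler_natCast hp hq]

/-- The Mittag-Leffler series is the inverse of the symbol `(1 - X) ^ q - lam (1 - X) ^ (q - p)`. -/
theorem symbol_mul_mittagLefflerSeries {p q lam : ℝ} (hp : 0 < p) (hq : 0 < q)
    (hlam : |lam| < 1) :
    (negBinomial (-q) - C lam * negBinomial (p - q)) * mittagLefflerSeries p q lam = 1 := by
  ext n
  rw [sub_mul, mul_assoc, map_sub, coeff_C_mul,
    coeff_negBinomial_mul_mittagLefflerSeries hp hq hlam,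
    coeff_negBinomial_mul_mittagLefflerSeries hp hq hlam,
    -- Telescoping: the terms `k ≥ 1` of the first series cancel the second, leaving `(1 - X)^0 =
    -- 1`.
    (summable_coeff_negBinomial hlam p _ n).tsum_eq_zero_add, ← tsum_mul_left]
  have (k : ℕ) : lam ^ (k + 1) * coeff n (negBinomial ((k + 1 : ℕ) * p + (q + -q))) =
      lam * (lam ^ k * coeff n (negBinomial (k * p + (q + (p - q))))) := by
    rw [show (((k + 1 : ℕ) : ℝ) * p + (q + -q) : ℝ) = k * p + (q + (p - q)) by push_cast; ring]
    ring
  simp_rw [this]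
  simp [negBinomial_zero]

/-! ### Fractional sums and differences as Cauchy products. -/

theorem coeff_succ_negBinomial_sub_one_mul (r : ℝ) (Y : PowerSeries ℝ) (n : ℕ) :
    coeff (n + 1) (negBinomial (r - 1) * Y) =
      coeff (n + 1) (negBinomial r * Y) - coeff n (negBinomial r * Y) := by
  rw [show r - 1 = -1 + r by ring, negBinomial_add, negBinomial_neg_one, mul_assoc, sub_mul,
    one_mul, map_sub, coeff_succ_X_mul]

theorem fracSum_add_natCast {ν : ℝ} (hν : 0 < ν) (a : ℝ) (y : ℝ → ℝ) (n : ℕ) :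
    fracSum ν a y (a + ν + n) =
      coeff n (negBinomial ν * PowerSeries.mk fun k => y (a + k)) := by
  have hfl : ⌊a + ν + n - ν - a + 1⌋₊ = n + 1 := by
    rw [show a + ν + n - ν - a + 1 = ((n + 1 : ℕ) : ℝ) by push_cast; ring, Nat.floor_natCast]
  rw [fracSum, hfl, mul_comm (negBinomial ν), coeff_mul,
    Finset.Nat.sum_antidiagonal_eq_sum_range_succ_mk, Finset.mul_sum]
  refine Finset.sum_congr rfl fun k hk => ?_
  have hk : k ≤ n := Nat.lt_succ_iff.1 (Finset.mem_range.1 hk)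
  rw [coeff_mk, coeff_negBinomial_eq_Gamma hν, fallingPow, Nat.cast_sub hk]
  ring_nf

theorem fracDiff_of_one_lt_of_lt_two {υ : ℝ} (h1 : 1 < υ) (h2 : υ < 2) (y : ℝ → ℝ) (n : ℕ) :
    fracDiff υ (υ - 2) y n =
      coeff (n + 2) (negBinomial (-υ) * PowerSeries.mk fun k => y (υ - 2 + k)) := by
  have hc : ⌈υ⌉₊ = 2 := by
    rw [Nat.ceil_eq_iff two_ne_zero]; constructor <;> norm_num <;> linarith
  have hs (m : ℕ) : fracSum (2 - υ) (υ - 2) y m =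
      coeff m (negBinomial (2 - υ) * PowerSeries.mk fun k => y (υ - 2 + k)) := by
    rw [← fracSum_add_natCast (by linarith)]
    congr 1; ring
  rw [show -υ = 2 - υ - 1 - 1 by ring, coeff_succ_negBinomial_sub_one_mul,
    coeff_succ_negBinomial_sub_one_mul, coeff_succ_negBinomial_sub_one_mul, ← hs, ← hs, ← hs,
    fracDiff, hc]
  simp only [Function.iterate_succ, Function.iterate_zero, Function.comp, id, fwdDiff]
  push_cast
  ring_nf

/-- Since `n + υ - μ = (υ - 2) + (1 - μ) + (n + 1)`, one difference reaches index `n + 2`, the same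
as for order `υ`. -/
theorem fracDiff_of_pos_of_lt_one {μ : ℝ} (h0 : 0 < μ) (h1 : μ < 1) (υ : ℝ) (y : ℝ → ℝ) (n : ℕ) :
    fracDiff μ (υ - 2) y (n + υ - μ) =
      coeff (n + 2) (negBinomial (-μ) * PowerSeries.mk fun k => y (υ - 2 + k)) := by
  have hc : ⌈μ⌉₊ = 1 := by
    rw [Nat.ceil_eq_iff one_ne_zero]; constructor <;> norm_num <;> linarith
  rw [show -μ = 1 - μ - 1 by ring, coeff_succ_negBinomial_sub_one_mul,
    ← fracSum_add_natCast (by linarith), ← fracSum_add_natCast (by linarith), fracDiff, hc]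
  simp only [Function.iterate_succ, Function.iterate_zero, Function.comp, id, fwdDiff]
  push_cast
  ring_nf

/-! ### The Volterra recursion and shooting. -/

/-- The solution of the discrete Volterra equation
`y (n + 1) = c E n - ∑_{j < n} F j (y (j + 1)) E (n - 1 - j)` with `y 0 = 0`. -/
def volterra (E : ℕ → ℝ) (F : ℕ → ℝ → ℝ) (c : ℝ) : ℕ → ℝ
  | 0 => 0
  | n + 1 => c * E n - ∑ j : Fin n, F j (volterra E F c (j + 1)) * E (n - 1 - j)

theorem volterra_zero (E : ℕ → ℝ) (F : ℕ → ℝ → ℝ) (c : ℝ) : volterra E F c 0 = 0 := by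
  rw [volterra]

theorem volterra_succ (E : ℕ → ℝ) (F : ℕ → ℝ → ℝ) (c : ℝ) (n : ℕ) :
    volterra E F c (n + 1) =
      c * E n - ∑ j ∈ Finset.range n, F j (volterra E F c (j + 1)) * E (n - 1 - j) := by
  rw [volterra, Finset.sum_range]

theorem continuous_volterra {E : ℕ → ℝ} {F : ℕ → ℝ → ℝ} {N : ℕ}
    (hF : ∀ j < N, Continuous (F j)) (n : ℕ) (hn : n ≤ N + 1) :
    Continuous fun c => volterra E F c n := by
  induction n using Nat.strong_induction_on with
  | _ n ih =>
    cases n with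
    | zero => simpa only [volterra_zero] using continuous_const
    | succ n =>
      rw [funext fun c => volterra_succ E F c n]
      refine (continuous_id.mul continuous_const).sub (continuous_finsetSum _ fun j hj => ?_)
      have hj := Finset.mem_range.1 hj
      exact ((hF j (by omega)).comp (ih (j + 1) (by omega) (by omega))).mul continuous_const

theorem exists_volterra_eq_zero {E : ℕ → ℝ} {F : ℕ → ℝ → ℝ} {N : ℕ} (hE : E N ≠ 0)
    (hF : ∀ j < N, Continuous (F j)) {B : ℕ → ℝ} (hB : ∀ j < N, ∀ r, |F j r| ≤ B j) :
    ∃ c, volterra E F c (N + 1) = 0 := by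
  set K := ∑ j ∈ Finset.range N, B j * |E (N - 1 - j)| with hK
  have hbound (c : ℝ) :
      |∑ j ∈ Finset.range N, F j (volterra E F c (j + 1)) * E (N - 1 - j)| ≤ K := by
    refine (Finset.abs_sum_le_sum_abs _ _).trans (Finset.sum_le_sum fun j hj => ?_)
    rw [abs_mul]
    exact mul_le_mul_of_nonneg_right (hB j (Finset.mem_range.1 hj) _) (abs_nonneg _)
  -- `K` bounds the sum uniformly in `c`, so `c * E N = ∓K` forces the two signs.
  refine mem_range_of_exists_le_of_exists_ge (continuous_volterra hF (N + 1) le_rfl)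
    ⟨-K / E N, ?_⟩ ⟨K / E N, ?_⟩
  · rw [volterra_succ, div_mul_cancel₀ _ hE]
    linarith [(abs_le.1 (hbound (-K / E N))).1]
  · rw [volterra_succ, div_mul_cancel₀ _ hE]
    linarith [(abs_le.1 (hbound (K / E N))).2]

theorem mk_volterra (E : ℕ → ℝ) (F : ℕ → ℝ → ℝ) (c : ℝ) :
    PowerSeries.mk (volterra E F c) =
      X * ((C c - X * PowerSeries.mk fun j => F j (volterra E F c (j + 1))) *
        PowerSeries.mk E) := by
  ext n
  cases n with
  | zero => rw [coeff_mk, volterra_zero, coeff_zero_X_mul]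
  | succ n =>
    rw [coeff_succ_X_mul, coeff_mk, volterra_succ, sub_mul, map_sub, coeff_C_mul, coeff_mk,
      mul_assoc]
    cases n with
    | zero => simp
    | succ n =>
      rw [coeff_succ_X_mul, coeff_mul, Finset.Nat.sum_antidiagonal_eq_sum_range_succ_mk]
      simp

theorem coeff_symbol_mul_volterra {p q lam : ℝ} (hp : 0 < p) (hq : 0 < q) (hlam : |lam| < 1)
    (F : ℕ → ℝ → ℝ) (c : ℝ) (n : ℕ) :
    -coeff (n + 2) (negBinomial (-q) *
        PowerSeries.mk (volterra (fun n => mittagLeffler p q lam n) F c)) +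
      lam * coeff (n + 2) (negBinomial (p - q) *
        PowerSeries.mk (volterra (fun n => mittagLeffler p q lam n) F c)) =
      F n (volterra (fun n => mittagLeffler p q lam n) F c (n + 1)) := by
  have h := symbol_mul_mittagLefflerSeries hp hq hlam
  rw [mittagLefflerSeries] at h
  set E : ℕ → ℝ := fun n => mittagLeffler p q lam n
  have key : (negBinomial (-q) - C lam * negBinomial (p - q)) *
      PowerSeries.mk (volterra E F c) =
      X * (C c - X * PowerSeries.mk fun j => F j (volterra E F c (j + 1))) := by
    rw [mk_volterra]
    linear_combination
      (X * (C c - X * PowerSeries.mk fun j => F j (volterra E F c (j + 1)))) * h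
  -- The parameter `c` sits in degree 1 only, so it drops out here.
  have := congrArg (coeff (n + 2)) key
  rw [sub_mul, mul_assoc, map_sub, coeff_C_mul, coeff_succ_X_mul, map_sub, coeff_succ_X_mul,
    coeff_mk, coeff_C, if_neg (Nat.succ_ne_zero n)] at this
  linarith

/-! ### Green's function representation. -/

theorem sum_grid (c : ℝ) (n : ℕ) (F : ℝ → ℝ) :
    ∑ s ∈ grid c n, F s = ∑ j ∈ Finset.range (n + 1), F (c + j) := by
  rw [grid, Finset.sum_map]; rfl

theorem green_left (α υ μ : ℝ) (b j : ℕ) : green α υ μ b (υ - 2) (υ - 1 + j) = 0 := by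
  have : ¬ (υ - 1 + j ≤ υ - 2) := by
    have : (0 : ℝ) ≤ j := j.cast_nonneg
    linarith
  rw [green, if_neg this, show υ - 2 - υ + 1 = -1 by ring, mittagLeffler_neg_one]
  simp

theorem green_succ (α υ μ : ℝ) {b j : ℕ} (hj : j ≤ b + 1) (m : ℕ) :
    green α υ μ b (υ - 2 + (m + 1 : ℕ)) (υ - 1 + j) =
      mittagLeffler (υ - μ) υ α m / mittagLeffler (υ - μ) υ α (b + 2) *
          mittagLeffler (υ - μ) υ α (b + 1 - j : ℕ) -
        if j < m then mittagLeffler (υ - μ) υ α (m - 1 - j : ℕ) else 0 := by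
  have e1 : υ - 2 + ((m + 1 : ℕ) : ℝ) - υ + 1 = m := by push_cast; ring
  have e2 : υ + b - (υ - 1 + j) = ((b + 1 - j : ℕ) : ℝ) := by push_cast [hj]; ring
  have e3 : υ - 1 + (j : ℝ) ≤ υ - 2 + ((m + 1 : ℕ) : ℝ) ↔ j ≤ m := by
    rw [← Nat.cast_le (α := ℝ)]; push_cast
    constructor <;> intro h <;> linarith
  rw [green, e1, e2]
  simp only [e3]
  rcases lt_trichotomy j m with h | rfl | h
  · rw [if_pos h.le, if_pos h]
    congr 2
    rw [Nat.cast_sub (by omega), Nat.cast_sub (by omega)]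
    push_cast; ring
  -- On the diagonal the subtracted term is the value at `-1`, which is zero.
  · rw [if_pos le_rfl, if_neg (lt_irrefl _),
      show υ - 2 + ((j + 1 : ℕ) : ℝ) - (υ - 1 + j) - 1 = -1 by push_cast; ring,
      mittagLeffler_neg_one]
  · rw [if_neg h.not_ge, if_neg (not_lt.2 h.le), sub_zero]

/-- A solution of the Volterra equation satisfying the right boundary condition is represented by
the Green's function. -/
theorem volterra_eq_sum_green {α υ μ : ℝ} {b : ℕ}
    (hne : mittagLeffler (υ - μ) υ α (b + 2) ≠ 0) {F : ℕ → ℝ → ℝ} {c : ℝ}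
    (hc : volterra (fun n => mittagLeffler (υ - μ) υ α n) F c (b + 3) = 0)
    {n : ℕ} (hn : n ≤ b + 3) :
    volterra (fun n => mittagLeffler (υ - μ) υ α n) F c n =
      ∑ j ∈ Finset.range (b + 2), green α υ μ b (υ - 2 + n) (υ - 1 + j) *
        F j (volterra (fun n => mittagLeffler (υ - μ) υ α n) F c (j + 1)) := by
  cases n with
  | zero =>
    rw [volterra_zero]
    simp [green_left]
  | succ m =>
    rw [volterra_succ] at hc ⊢
    set y := volterra (fun n => mittagLeffler (υ - μ) υ α n) F c
    set e := mittagLeffler (υ - μ) υ α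
    have hsum : ∑ j ∈ Finset.range (b + 2), green α υ μ b (υ - 2 + (m + 1 : ℕ)) (υ - 1 + j) *
          F j (y (j + 1)) =
        e m / e (b + 2) * ∑ j ∈ Finset.range (b + 2), F j (y (j + 1)) * e (b + 2 - 1 - j : ℕ) -
        ∑ j ∈ Finset.range (b + 2),
          if j < m then F j (y (j + 1)) * e (m - 1 - j : ℕ) else 0 := by
      rw [Finset.mul_sum, ← Finset.sum_sub_distrib]
      refine Finset.sum_congr rfl fun j hj => ?_
      rw [green_succ _ _ _ (Nat.lt_succ_iff.1 (Finset.mem_range.1 hj)),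
        show b + 2 - 1 - j = b + 1 - j by omega]
      split_ifs <;> ring
    have hfil : (Finset.range (b + 2)).filter (· < m) = Finset.range m := by
      ext j; simp only [Finset.mem_filter, Finset.mem_range]; omega
    -- The right boundary condition identifies the full sum with `c * e (b + 2)`.
    rw [hsum, ← Finset.sum_filter, hfil, ← sub_eq_zero.1 hc]
    push_cast
    field_simp

end FracDirichlet

end

/-! ### The nonlinear problem. -/

theorem mainTheorem3 (α υ μ : ℝ) (b : ℕ)
    (hμ : 0 < μ ∧ μ < 1) (hυ : 1 < υ ∧ υ < 2) (hα : |α| < 1)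
    (hne : FracDirichlet.mittagLeffler (υ - μ) υ α (b + 2) ≠ 0)
    (f : ℝ → ℝ → ℝ)
    (hf : ∀ s ∈ FracDirichlet.grid (υ - 1) (b + 1), Continuous (f s))
    (ψ g : ℝ → ℝ)
    (hψ_nonneg : ∀ r, 0 ≤ r → 0 ≤ ψ r)
    (hψ_mono : MonotoneOn ψ (Set.Ici 0))
    (hg : ∀ t ∈ FracDirichlet.grid (υ - 2) (b + 3), 0 ≤ g t)
    (hA1 : ∀ t ∈ FracDirichlet.grid 0 (b + 1), ∀ r : ℝ,
      |f (t + υ - 1) r| ≤ g (t + υ - 1) * ψ |r|)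
    (hA2 : ∃ L : ℝ, 0 < L ∧
      ψ L * (FracDirichlet.grid (υ - 2) (b + 3)).sup' (FracDirichlet.grid_nonempty _ _)
        (fun t => ∑ s ∈ FracDirichlet.grid (υ - 1) (b + 1),
          g s * |FracDirichlet.green α υ μ b t s|) < L) :
    (∃ y : ℝ → ℝ, FracDirichlet.IsSolution α υ μ b f y) ∧
    ((∃ t ∈ FracDirichlet.grid 0 (b + 1), f (t + υ - 1) 0 ≠ 0) →
      ∀ y : ℝ → ℝ, FracDirichlet.IsSolution α υ μ b f y →
        ∃ t ∈ FracDirichlet.grid (υ - 2) (b + 3), y t ≠ 0) := by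
  obtain ⟨hμ0, hμ1⟩ := hμ
  obtain ⟨hυ1, hυ2⟩ := hυ
  refine ⟨?_, ?_⟩
  · obtain ⟨L, hL, hlt⟩ := hA2
    have hψL := hψ_nonneg L hL.le
    let clamp : ℝ → ℝ := fun r => max (-L) (min r L)
    have hclamp (r : ℝ) : |clamp r| ≤ L :=
      abs_le.2 ⟨le_max_left _ _, max_le (by linarith) (min_le_right _ _)⟩
    let F : ℕ → ℝ → ℝ := fun j r => f (υ - 1 + j) (clamp r)
    have hgj (j : ℕ) (hj : j < b + 2) : 0 ≤ g (υ - 1 + j) :=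
      hg _ (FracDirichlet.mem_grid.2 ⟨j + 1, by omega, by push_cast; ring⟩)
    have hFc (j : ℕ) (hj : j < b + 2) : Continuous (F j) :=
      (hf _ (FracDirichlet.mem_grid.2 ⟨j, by omega, rfl⟩)).comp
        (continuous_const.max (continuous_id.min continuous_const))
    have hFb (j : ℕ) (hj : j < b + 2) (r : ℝ) : |F j r| ≤ g (υ - 1 + j) * ψ L := by
      have h := hA1 j (FracDirichlet.mem_grid.2 ⟨j, by omega, by simp⟩) (clamp r)
      rw [show (j : ℝ) + υ - 1 = υ - 1 + j by ring] at h
      exact h.trans (mul_le_mul_of_nonneg_left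
        (hψ_mono (Set.mem_Ici.2 (abs_nonneg _)) (Set.mem_Ici.2 hL.le) (hclamp r)) (hgj j hj))
    obtain ⟨c, hc⟩ := FracDirichlet.exists_volterra_eq_zero
      (E := fun n => FracDirichlet.mittagLeffler (υ - μ) υ α n) (N := b + 2)
      (by push_cast; exact hne) hFc hFb
    set Y := FracDirichlet.volterra (fun n => FracDirichlet.mittagLeffler (υ - μ) υ α n) F c
      with hY
    have hYL (n : ℕ) (hn : n ≤ b + 3) : |Y n| ≤ L := by
      rw [hY, FracDirichlet.volterra_eq_sum_green hne hc hn]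
      have hmem : υ - 2 + (n : ℝ) ∈ FracDirichlet.grid (υ - 2) (b + 3) :=
        FracDirichlet.mem_grid.2 ⟨n, hn, rfl⟩
      refine le_trans ?_ ((mul_le_mul_of_nonneg_left (Finset.le_sup' (fun t =>
        ∑ s ∈ FracDirichlet.grid (υ - 1) (b + 1), g s * |FracDirichlet.green α υ μ b t s|)
        hmem) hψL).trans hlt.le)
      rw [FracDirichlet.sum_grid, Finset.mul_sum]
      refine (Finset.abs_sum_le_sum_abs _ _).trans (Finset.sum_le_sum fun j hj => ?_)
      rw [abs_mul]
      calc _ ≤ |FracDirichlet.green α υ μ b (υ - 2 + n) (υ - 1 + j)| *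
            (g (υ - 1 + j) * ψ L) :=
            mul_le_mul_of_nonneg_left (hFb j (Finset.mem_range.1 hj) _) (abs_nonneg _)
        _ = _ := by ring
    let y : ℝ → ℝ := fun x => Y ⌊x - (υ - 2)⌋₊
    have hy (n : ℕ) : y (υ - 2 + n) = Y n := by
      simp only [y, add_sub_cancel_left, Nat.floor_natCast]
    have hymk : (PowerSeries.mk fun k => y (υ - 2 + k)) = PowerSeries.mk Y := by
      simp only [hy]
    refine ⟨y, ⟨fun t ht => ?_, ?_, ?_⟩⟩
    · obtain ⟨n, hn, rfl⟩ := FracDirichlet.mem_grid.1 ht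
      rw [zero_add, FracDirichlet.fracDiff_of_one_lt_of_lt_two hυ1 hυ2,
        FracDirichlet.fracDiff_of_pos_of_lt_one hμ0 hμ1, hymk,
        show (n : ℝ) + υ - 1 = υ - 2 + (n + 1 : ℕ) by push_cast; ring, hy]
      have h := FracDirichlet.coeff_symbol_mul_volterra (p := υ - μ) (q := υ)
        (by linarith) (by linarith) hα F c n
      rw [← hY, show υ - μ - υ = -μ by ring] at h
      rw [h]
      -- The a priori bound removes the clamp.
      have hb := abs_le.1 (hYL (n + 1) (by omega))
      simp only [F, clamp, min_eq_left hb.2, max_eq_right hb.1]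
      congr 1
      push_cast; ring
    · simpa [hY, FracDirichlet.volterra_zero] using hy 0
    · rw [show υ + b + 1 = υ - 2 + (b + 3 : ℕ) by push_cast; ring, hy]
      exact hc
  · rintro ⟨t, ht, hft⟩ y hsol
    by_contra! h0
    apply hft
    have heq := hsol.equation t ht
    obtain ⟨n, hn, rfl⟩ := FracDirichlet.mem_grid.1 ht
    have hz (k : ℕ) (hk : k ≤ b + 3) : y (υ - 2 + k) = 0 :=
      h0 _ (FracDirichlet.mem_grid.2 ⟨k, hk, rfl⟩)
    -- Only values at indices up to `n + 2 ≤ b + 3` enter, so vanishing on the grid kills both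
    -- differences.
    have hcoeff (r : ℝ) : PowerSeries.coeff (n + 2) (FracDirichlet.negBinomial r *
        PowerSeries.mk fun k => y (υ - 2 + k)) = 0 := by
      rw [PowerSeries.coeff_mul]
      refine Finset.sum_eq_zero fun ij hij => ?_
      have := Finset.HasAntidiagonal.mem_antidiagonal.1 hij
      rw [PowerSeries.coeff_mk, hz _ (by omega), mul_zero]
    have hy1 : y (0 + (n : ℝ) + υ - 1) = 0 := by
      rw [show 0 + (n : ℝ) + υ - 1 = υ - 2 + (n + 1 : ℕ) by push_cast; ring, hz _ (by omega)]
    rw [hy1] at heq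
    rw [← heq, zero_add, FracDirichlet.fracDiff_of_one_lt_of_lt_two hυ1 hυ2,
      FracDirichlet.fracDiff_of_pos_of_lt_one hμ0 hμ1, hcoeff, hcoeff]
    simp
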